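/- Let $M$ be a topological space; homology and cohomology are singular. For $w\in H^2(M;\mathbb{Z}_2)$ and $B\in H_2(M;\mathbb{Z})$ let $w(B)\in\mathbb{Z}_2$ denote the value of $w$ on the mod $2$ reduction of $B$, and for $\kappa\in H^1(M;\mathbb{Z}_2)$ let $\kappa^2=\kappa\cup\kappa\in H^2(M;\mathbb{Z}_2)$. Then $$\{w\in H^2(M;\mathbb{Z}_2) : w(B)=0 \ \ \forall\, B\in H_2(M;\mathbb{Z})\}\ \supset\ \{\kappa^2 : \kappa\in H^1(M;\mathbb{Z}_2)\}.$$ If $H_1(M;\mathbb{Z})$ is finitely generated, then the reverse inclusion $$\{w\in H^2(M;\mathbb{Z}_2) : w(B)=0 \ \ \forall\, B\in H_2(M;\mathbb{Z})\}\ \subset\ \{\kappa^2 : \kappa\in H^1(M;\mathbb{Z}_2)\}$$ holds if and only if $H_1(M;\mathbb{Z})$ has no $4$-torsion, i.e. contains no element of order exactly $4$. -/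

import Mathlib

universe u

noncomputable section

namespace SingularCohomology

open CategoryTheory

/-! ### Cochains of a simplicial set with coefficients in a commutative ring -/

section Cochains

/-- The set of `n`-simplices of a simplicial set. -/
abbrev Simplex (X : SSet.{u}) (n : ℕ) : Type u := X.obj (Opposite.op (SimplexCategory.mk n))

variable (X : SSet.{u}) (R : Type) [CommRing R]

/-- `n`-cochains of `X` with coefficients in `R`: functions on the set of `n`-simplices. -/
abbrev Cochain (n : ℕ) : Type u := Simplex X n → R

/-- The coboundary operator, `(d φ)(σ) = ∑ i, (-1)^i φ(∂_i σ)`. -/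
def coboundary (n : ℕ) : Cochain X R n →ₗ[R] Cochain X R (n + 1) where
  toFun φ σ := ∑ i : Fin (n + 2), (-1 : R) ^ i.val * φ (X.δ i σ)
  map_add' φ ψ := by
    funext σ
    simp [mul_add, Finset.sum_add_distrib]
  map_smul' r φ := by
    funext σ
    simp only [Pi.smul_apply, smul_eq_mul, RingHom.id_apply, Finset.mul_sum]
    exact Finset.sum_congr rfl fun i _ => by ring

/-- The module of `n`-cocycles. -/
def cocycles (n : ℕ) : Submodule R (Cochain X R n) := LinearMap.ker (coboundary X R n)

/-- The module of `n`-coboundaries; in degree `0` it is trivial. -/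
def coboundaries : (n : ℕ) → Submodule R (Cochain X R n)
  | 0 => ⊥
  | n + 1 => LinearMap.range (coboundary X R n)

/-- The `n`-th cohomology of `X` with coefficients in `R`: cocycles modulo coboundaries. -/
abbrev Cohomology (n : ℕ) : Type u :=
  cocycles X R n ⧸ (coboundaries X R n).submoduleOf (cocycles X R n)

variable {X R}

lemma coboundary_zero_apply (f : Cochain X R 0) (σ : Simplex X 1) :
    coboundary X R 0 f σ = f (X.δ 0 σ) - f (X.δ 1 σ) := by
  simp [coboundary, Fin.sum_univ_succ]
  ring

lemma coboundary_one_apply (φ : Cochain X R 1) (σ : Simplex X 2) :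
    coboundary X R 1 φ σ = φ (X.δ 0 σ) - φ (X.δ 1 σ) + φ (X.δ 2 σ) := by
  simp [coboundary, Fin.sum_univ_succ]
  ring

lemma coboundary_two_apply (φ : Cochain X R 2) (σ : Simplex X 3) :
    coboundary X R 2 φ σ =
      φ (X.δ 0 σ) - φ (X.δ 1 σ) + φ (X.δ 2 σ) - φ (X.δ 3 σ) := by
  simp [coboundary, Fin.sum_univ_succ]
  ring

/-- The simplicial identity `∂_i ∂_{j+1} = ∂_j ∂_i` for `i ≤ j`, on elements. -/
lemma face_face {n : ℕ} {i j : Fin (n + 2)} (h : i ≤ j) (σ : Simplex X (n + 2)) :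
    X.δ i (X.δ j.succ σ) = X.δ j (X.δ i.castSucc σ) :=
  ConcreteCategory.congr_hom (X.δ_comp_δ h) σ

/-- The cup product of two `1`-cochains: on a `2`-simplex `σ = [v₀, v₁, v₂]` its value is
`φ [v₀, v₁] * ψ [v₁, v₂]`, where `[v₀, v₁] = ∂₂ σ` and `[v₁, v₂] = ∂₀ σ`. -/
def cupCochain (φ ψ : Cochain X R 1) : Cochain X R 2 :=
  fun σ => φ (X.δ 2 σ) * ψ (X.δ 0 σ)

lemma cupCochain_mem_cocycles {φ ψ : Cochain X R 1}
    (hφ : φ ∈ cocycles X R 1) (hψ : ψ ∈ cocycles X R 1) :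
    cupCochain φ ψ ∈ cocycles X R 2 := by
  rw [cocycles, LinearMap.mem_ker] at *
  funext σ
  have h1 := congrFun hφ (X.δ 3 σ)
  have h2 := congrFun hψ (X.δ 0 σ)
  rw [coboundary_one_apply, Pi.zero_apply] at h1 h2
  rw [coboundary_two_apply, Pi.zero_apply]
  simp only [cupCochain]
  have e01 : X.δ 0 (X.δ 1 σ) = X.δ 0 (X.δ 0 σ) :=
    face_face (i := 0) (j := 0) (by decide) σ
  have e02 : X.δ 0 (X.δ 2 σ) = X.δ 1 (X.δ 0 σ) :=
    face_face (i := 0) (j := 1) (by decide) σ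
  have e03 : X.δ 0 (X.δ 3 σ) = X.δ 2 (X.δ 0 σ) :=
    face_face (i := 0) (j := 2) (by decide) σ
  have e13 : X.δ 1 (X.δ 3 σ) = X.δ 2 (X.δ 1 σ) :=
    face_face (i := 1) (j := 2) (by decide) σ
  have e23 : X.δ 2 (X.δ 3 σ) = X.δ 2 (X.δ 2 σ) :=
    face_face (i := 2) (j := 2) (by decide) σ
  rw [e03, e13, e23] at h1
  rw [e01, e02, e23, e03]
  linear_combination ψ (X.δ 0 (X.δ 0 σ)) * h1 - φ (X.δ 2 (X.δ 2 σ)) * h2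

lemma cupCochain_coboundary_left (f : Cochain X R 0) {ψ : Cochain X R 1}
    (hψ : ψ ∈ cocycles X R 1) :
    cupCochain (coboundary X R 0 f) ψ ∈ coboundaries X R 2 := by
  rw [cocycles, LinearMap.mem_ker] at hψ
  refine ⟨fun σ => f (X.δ 1 σ) * ψ σ, ?_⟩
  funext σ
  have h := congrFun hψ σ
  rw [coboundary_one_apply, Pi.zero_apply] at h
  simp only [cupCochain, coboundary_one_apply, coboundary_zero_apply]
  have e02 : X.δ 0 (X.δ 2 σ) = X.δ 1 (X.δ 0 σ) :=
    face_face (i := 0) (j := 1) (by decide) σ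
  have e12 : X.δ 1 (X.δ 2 σ) = X.δ 1 (X.δ 1 σ) :=
    face_face (i := 1) (j := 1) (by decide) σ
  rw [e02, e12]
  linear_combination f (X.δ 1 (X.δ 1 σ)) * h

lemma cupCochain_coboundary_right (f : Cochain X R 0) {φ : Cochain X R 1}
    (hφ : φ ∈ cocycles X R 1) :
    cupCochain φ (coboundary X R 0 f) ∈ coboundaries X R 2 := by
  rw [cocycles, LinearMap.mem_ker] at hφ
  refine ⟨fun σ => - (φ σ * f (X.δ 0 σ)), ?_⟩
  funext σ
  have h := congrFun hφ σ
  rw [coboundary_one_apply, Pi.zero_apply] at h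
  simp only [cupCochain, coboundary_one_apply, coboundary_zero_apply]
  have e01 : X.δ 0 (X.δ 1 σ) = X.δ 0 (X.δ 0 σ) :=
    face_face (i := 0) (j := 0) (by decide) σ
  have e02 : X.δ 0 (X.δ 2 σ) = X.δ 1 (X.δ 0 σ) :=
    face_face (i := 0) (j := 1) (by decide) σ
  rw [e01, e02]
  linear_combination (- f (X.δ 0 (X.δ 0 σ))) * h

/-- The cup product `H¹(X; R) × H¹(X; R) → H²(X; R)`. -/
def cup : Cohomology X R 1 → Cohomology X R 1 → Cohomology X R 2 :=
  Quotient.map₂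
    (fun φ ψ => ⟨cupCochain φ.1 ψ.1, cupCochain_mem_cocycles φ.2 ψ.2⟩) (by
      intro φ φ' hφ ψ ψ' hψ
      obtain ⟨f, hf⟩ : φ.1 - φ'.1 ∈ coboundaries X R 1 :=
        (Submodule.quotientRel_def ((coboundaries X R 1).submoduleOf (cocycles X R 1))).1 hφ
      obtain ⟨g, hg⟩ : ψ.1 - ψ'.1 ∈ coboundaries X R 1 :=
        (Submodule.quotientRel_def ((coboundaries X R 1).submoduleOf (cocycles X R 1))).1 hψ
      refine (Submodule.quotientRel_def _).2 ?_
      have h : cupCochain φ.1 ψ.1 - cupCochain φ'.1 ψ'.1 =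
          cupCochain (coboundary X R 0 f) ψ.1 + cupCochain φ'.1 (coboundary X R 0 g) := by
        rw [hf, hg]
        funext σ
        simp only [cupCochain, Pi.sub_apply, Pi.add_apply]
        ring
      change cupCochain φ.1 ψ.1 - cupCochain φ'.1 ψ'.1 ∈ coboundaries X R 2
      rw [h]
      exact add_mem (cupCochain_coboundary_left f ψ.2) (cupCochain_coboundary_right g φ'.2))

end Cochains

/-! ### The pairing of cohomology with integral homology -/

section Pairing

/-- The coefficient group `ℤ`, in the universe of the space. -/
abbrev intCoeff : ModuleCat.{u} ℤ := ModuleCat.of ℤ (ULift.{u} ℤ)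

variable {X : SSet.{u}} {R : Type} [CommRing R]

/-- The extension of an `n`-cochain `φ` to a homomorphism from the integral `n`-chains to `R`:
on the summand `ℤ` of a simplex `σ` it is `k ↦ k • φ σ`. -/
def evalChain {n : ℕ} (φ : Cochain X R n) :
    (X.chainComplex intCoeff.{u}).X n ⟶ ModuleCat.of ℤ (ULift.{u} R) :=
  Limits.Cofan.IsColimit.desc (X.isColimitChainComplexXCofan intCoeff.{u} n) fun σ =>
    ModuleCat.ofHom ((LinearMap.toSpanSingleton ℤ (ULift.{u} R) (ULift.up (φ σ))).comp
      (ULift.moduleEquiv : ULift.{u} ℤ ≃ₗ[ℤ] ℤ).toLinearMap)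

@[simp]
lemma ι_evalChain {n : ℕ} (φ : Cochain X R n) (σ : Simplex X n) :
    X.ιChainComplex (R := intCoeff.{u}) σ ≫ evalChain φ =
      ModuleCat.ofHom ((LinearMap.toSpanSingleton ℤ (ULift.{u} R) (ULift.up (φ σ))).comp
        (ULift.moduleEquiv : ULift.{u} ℤ ≃ₗ[ℤ] ℤ).toLinearMap) :=
  Limits.Cofan.IsColimit.fac (X.isColimitChainComplexXCofan intCoeff.{u} n) _ σ

lemma evalChain_sub {n : ℕ} (φ ψ : Cochain X R n) :
    evalChain (φ - ψ) = evalChain φ - evalChain ψ := by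
  refine SSet.chainComplex_hom_ext fun σ => ?_
  rw [Preadditive.comp_sub, ι_evalChain, ι_evalChain, ι_evalChain]
  ext
  simp [mul_sub]

lemma d_evalChain {n : ℕ} (φ : Cochain X R n) :
    (X.chainComplex intCoeff.{u}).d (n + 1) n ≫ evalChain φ =
      evalChain (coboundary X R n φ) := by
  refine SSet.chainComplex_hom_ext fun σ => ?_
  rw [SSet.ιChainComplex_d_assoc, Preadditive.sum_comp]
  simp only [Preadditive.zsmul_comp, ι_evalChain]
  ext
  simp only [coboundary, ModuleCat.hom_sum, ModuleCat.hom_zsmul, ModuleCat.hom_ofHom,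
    LinearMap.sum_apply, LinearMap.smul_apply, LinearMap.comp_apply, LinearMap.toSpanSingleton_apply,
    LinearMap.coe_mk, AddHom.coe_mk]
  have h := fun f : Fin (n + 2) → ULift.{u} R =>
    map_sum (ULift.ringEquiv : ULift.{u} R ≃+* R) f Finset.univ
  refine (h _).trans ?_
  simp [Finset.mul_sum, mul_left_comm]
  rfl

lemma d_evalChain_eq_zero {n : ℕ} (φ : cocycles X R n) :
    (X.chainComplex intCoeff.{u}).d (n + 1) n ≫ evalChain φ.1 = 0 := by
  rw [d_evalChain, LinearMap.mem_ker.1 φ.2, ← sub_self (0 : Cochain X R (n + 1)),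
    evalChain_sub, sub_self]

/-- The homomorphism `H_n(X; ℤ) → R` given by an `n`-cocycle. -/
def evalHomology {n : ℕ} (φ : cocycles X R n) :
    X.homology intCoeff.{u} n ⟶ ModuleCat.of ℤ (ULift.{u} R) :=
  (X.chainComplex intCoeff.{u}).homologyι n ≫
    (X.chainComplex intCoeff.{u}).descOpcycles (evalChain φ.1) (n + 1) (by simp)
      (d_evalChain_eq_zero φ)

lemma evalHomology_congr {n : ℕ} (φ ψ : cocycles X R n)
    (h : φ.1 - ψ.1 ∈ coboundaries X R n) : evalHomology φ = evalHomology ψ := by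
  rw [← sub_eq_zero, evalHomology, evalHomology, ← Preadditive.comp_sub]
  cases n with
  | zero =>
    have h' : φ = ψ := Subtype.ext (sub_eq_zero.1 ((Submodule.mem_bot R).1 h))
    subst h'
    simp
  | succ n =>
    obtain ⟨f, hf⟩ := h
    rw [← (X.chainComplex intCoeff.{u}).homologyι_descOpcycles_eq_zero_of_boundary
      (evalChain (φ.1 - ψ.1)) (n + 2) (by simp) (evalChain f) (by rw [d_evalChain, hf])]
    congr 1
    rw [← cancel_epi ((X.chainComplex intCoeff.{u}).pOpcycles (n + 1)), Preadditive.comp_sub]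
    simp [evalChain_sub]

/-- The evaluation `w(B)` of `w ∈ Hⁿ(X; R)` on an integral class `B ∈ H_n(X; ℤ)`. -/
def pairing {n : ℕ} (w : Cohomology X R n) (B : (X.homology intCoeff.{u} n : ModuleCat.{u} ℤ)) : R :=
  Quotient.liftOn w (fun φ => ((evalHomology φ).hom B).down) fun φ ψ h => by
    rw [evalHomology_congr φ ψ ((Submodule.quotientRel_def
      ((coboundaries X R n).submoduleOf (cocycles X R n))).1 h)]

end Pairing

/-! ### Singular homology and cohomology of a topological space -/

section Singular

variable (M : Type u) [TopologicalSpace M]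

/-- `H_n(M; ℤ)`, Mathlib's singular homology. -/
abbrev singularHomology (n : ℕ) : ModuleCat.{u} ℤ :=
  ((AlgebraicTopology.singularHomologyFunctor (ModuleCat.{u} ℤ) n).obj intCoeff.{u}).obj
    (TopCat.of M)

/-- `Hⁿ(M; ℤ₂)`, the singular cohomology: the cohomology of the singular simplicial set of `M`. -/
abbrev singularCohomology (n : ℕ) : Type u :=
  Cohomology (TopCat.toSSet.obj (TopCat.of M)) (ZMod 2) n

variable {M}

/-- The value `w(B) ∈ ℤ₂` of `w ∈ Hⁿ(M; ℤ₂)` on `B ∈ H_n(M; ℤ)`. -/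
def evalOn {n : ℕ} (w : singularCohomology M n) (B : singularHomology M n) : ZMod 2 :=
  pairing (X := TopCat.toSSet.obj (TopCat.of M)) w B

end Singular

end SingularCohomology

end

section

open CategoryTheory

namespace HomologicalComplex

variable {S : Type*} [Ring S] {ι : Type*} {c : ComplexShape ι}
  (K : HomologicalComplex (ModuleCat.{u} S) c)

lemma pOpcycles_apply_eq_zero_iff {i j : ι} (hj : c.prev i = j) (x : K.X i) :
    (K.pOpcycles i).hom x = 0 ↔ ∃ y : K.X j, (K.d j i).hom y = x := by
  subst hj
  exact (K.sc i).moduleCat_pOpcycles_eq_zero_iff x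

lemma homologyι_apply_injective (i : ι) : Function.Injective (K.homologyι i).hom :=
  (ModuleCat.mono_iff_injective _).1 inferInstance

lemma exists_homologyι_apply_eq {i j : ι} (hj : c.next i = j) (x : K.X i)
    (hx : (K.d i j).hom x = 0) :
    ∃ h : K.homology i, (K.homologyι i).hom h = (K.pOpcycles i).hom x := by
  subst hj
  let z := (K.sc i).moduleCatCyclesIso.inv.hom ⟨x, hx⟩
  have hz : (K.iCycles i).hom z = x :=
    congrArg (fun f => f.hom ⟨x, hx⟩) (K.sc i).moduleCatCyclesIso_inv_iCycles
  refine ⟨(K.homologyπ i).hom z, ?_⟩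
  rw [← hz]
  exact congrArg (fun f => f.hom z) (K.homology_π_ι i)

lemma exists_cycle_homologyι_apply_eq (i j : ι) (h : K.homology i) :
    ∃ x : K.X i, (K.d i j).hom x = 0 ∧ (K.homologyι i).hom h = (K.pOpcycles i).hom x := by
  obtain ⟨z, rfl⟩ := (ModuleCat.epi_iff_surjective (K.homologyπ i)).1 inferInstance h
  exact ⟨(K.iCycles i).hom z, congrArg (fun f => f.hom z) (K.iCycles_d i j),
    congrArg (fun f => f.hom z) (K.homology_π_ι i)⟩

end HomologicalComplex

lemma ModuleCat.submodule_eq_top_of_hom_ext {S : Type*} [Ring S] {V : ModuleCat.{u} S}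
    (P : Submodule S V)
    (h : ∀ (T : ModuleCat.{u} S) (f g : V ⟶ T), (∀ x ∈ P, f.hom x = g.hom x) → f = g) :
    P = ⊤ := by
  rw [← P.ker_mkQ, LinearMap.ker_eq_top]
  exact congrArg ModuleCat.Hom.hom (h (ModuleCat.of S (V ⧸ P)) (ModuleCat.ofHom P.mkQ) 0
    fun x hx => (Submodule.Quotient.mk_eq_zero P).2 hx)

lemma LinearMap.ext_ulift {S V : Type*} [Semiring S] [AddCommMonoid V] [Module S V]
    {f g : ULift.{u} S →ₗ[S] V} (h : f (ULift.up 1) = g (ULift.up 1)) : f = g := by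
  ext k
  have hk : k = k.down • ULift.up 1 := ULift.ext _ _ (mul_one k.down).symm
  rw [hk, map_smul, map_smul, h]

lemma AddMonoidHom.eq_of_eqOn_span_int {A G : Type*} [AddCommGroup A] [inst : Module ℤ A]
    [AddCommGroup G] {s : Set A} (hs : Submodule.span ℤ s = ⊤) {f g : A →+ G}
    (h : s.EqOn f g) : f = g := by
  obtain rfl : inst = AddCommGroup.toIntModule A := Subsingleton.elim _ _
  have : f.toIntLinearMap = g.toIntLinearMap := LinearMap.ext_on hs h
  exact AddMonoidHom.ext fun a => LinearMap.congr_fun this a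

lemma Module.Baer.zmod_four : Module.Baer (ZMod 4) (ZMod 4) := by
  intro I g
  have : IsPrincipalIdealRing (ZMod 4) :=
    IsPrincipalIdealRing.of_surjective (Int.castRingHom (ZMod 4)) ZMod.intCast_surjective
  obtain ⟨a, rfl⟩ := (IsPrincipalIdealRing.principal I).principal
  have ha : a ∈ Submodule.span (ZMod 4) {a} := Submodule.mem_span_singleton_self a
  have key : ∀ a b : ZMod 4, (∀ r, r * a = 0 → r * b = 0) → ∃ t, a * t = b := by decide
  obtain ⟨t, ht⟩ := key a (g ⟨a, ha⟩) fun r hr => by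
    rw [← smul_eq_mul, ← map_smul]
    have : r • (⟨a, ha⟩ : Submodule.span (ZMod 4) {a}) = 0 := Subtype.ext hr
    rw [this, map_zero]
  refine ⟨LinearMap.toSpanSingleton _ _ t, ?_⟩
  intro x hx
  obtain ⟨r, rfl⟩ := Submodule.mem_span_singleton.1 hx
  have : (⟨r • a, hx⟩ : Submodule.span (ZMod 4) {a}) = r • ⟨a, ha⟩ := rfl
  rw [this, map_smul g, ← ht]
  simp [mul_assoc]

section Extension

variable {A B : Type*} [AddCommGroup A] [AddCommGroup B]

/-- Homomorphisms to the self-injective ring `ℤ/4` extend along `f` as soon as they vanish on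
`f ⁻¹ (4 B)`. -/
lemma exists_comp_eq_of_zmod_four (f : A →+ B) (W : A →+ ZMod 4)
    (hW : ∀ a b, f a = 4 • b → W a = 0) : ∃ m : B →+ ZMod 4, m.comp f = W := by
  let f' : ModN A 4 →ₗ[ZMod 4] ModN B 4 := ModN.liftEquiv'.symm
    ⟨(ModN.mkQ 4).comp f, fun a => by
      rw [AddMonoidHom.comp_apply, ← map_nsmul]
      exact (Submodule.Quotient.mk_eq_zero _).2 ⟨f a, natCast_zsmul _ 4⟩⟩
  let W' : ModN A 4 →ₗ[ZMod 4] ZMod 4 := ModN.liftEquiv'.symm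
    ⟨W, fun a => by
      rw [← Nat.cast_smul_eq_nsmul (ZMod 4), CharP.cast_eq_zero, zero_smul]⟩
  have hf' : ∀ a, f' (ModN.mkQ 4 a) = ModN.mkQ 4 (f a) := fun a => rfl
  have hW' : ∀ a, W' (ModN.mkQ 4 a) = W a := fun a => rfl
  have hker : LinearMap.ker f' ≤ LinearMap.ker W' := by
    intro x hx
    obtain ⟨a, rfl⟩ := Submodule.mkQ_surjective _ x
    have h : (ModN.mkQ 4 (f a)) = 0 := hx
    obtain ⟨b, hb⟩ := (Submodule.Quotient.mk_eq_zero _).1 h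
    exact hW a b (hb.symm.trans (natCast_zsmul b 4))
  obtain ⟨m, hm⟩ := Module.Baer.zmod_four.extension_property ((LinearMap.ker f').liftQ f' le_rfl)
    (LinearMap.ker_eq_bot.1 (Submodule.ker_liftQ_eq_bot _ _ _ le_rfl))
    ((LinearMap.ker f').liftQ W' hker)
  refine ⟨m.toAddMonoidHom.comp (ModN.mkQ 4), ?_⟩
  ext a
  have := LinearMap.congr_fun hm ((LinearMap.ker f').mkQ (ModN.mkQ 4 a))
  exact this

/-- A homomorphism to `ℤ/2` separates an element that is not divisible by `2` modulo `N`
from `N`. -/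
lemma exists_hom_zmod_two_ne_zero (N : AddSubgroup A) (a : A)
    (ha : ∀ b : A, a - 2 • b ∉ N) :
    ∃ g : A →+ ZMod 2, (∀ x ∈ N, g x = 0) ∧ g a ≠ 0 := by
  have hne : ModN.mkQ 2 (QuotientAddGroup.mk' N a) ≠ 0 := by
    intro h
    obtain ⟨b, hb⟩ := (Submodule.Quotient.mk_eq_zero _).1 h
    obtain ⟨b, rfl⟩ := QuotientAddGroup.mk'_surjective N b
    apply ha b
    rw [← QuotientAddGroup.eq_zero_iff, ← QuotientAddGroup.mk'_apply, map_sub, map_nsmul, ← hb]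
    exact sub_eq_zero.2 (natCast_zsmul _ 2)
  obtain ⟨g, hg⟩ : ∃ g : Module.Dual (ZMod 2) (ModN (A ⧸ N) 2),
      g (ModN.mkQ 2 (QuotientAddGroup.mk' N a)) ≠ 0 := by
    by_contra! h
    exact hne ((Module.forall_dual_apply_eq_zero_iff (ZMod 2) _).1 h)
  refine ⟨(g.toAddMonoidHom.comp (ModN.mkQ 2)).comp (QuotientAddGroup.mk' N), ?_, hg⟩
  intro x hx
  have : QuotientAddGroup.mk' N x = 0 := (QuotientAddGroup.eq_zero_iff x).2 hx
  rw [AddMonoidHom.comp_apply, this, map_zero]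

end Extension

end

noncomputable section

namespace SingularCohomology

open CategoryTheory

section Chains

variable {X : SSet.{u}}

variable (X) in
/-- The module of integral `n`-chains of `X`. -/
abbrev Chain (n : ℕ) : ModuleCat.{u} ℤ := (X.chainComplex intCoeff.{u}).X n

/-- The boundary operator on integral chains. -/
abbrev boundary (n : ℕ) : Chain X (n + 1) →ₗ[ℤ] Chain X n :=
  ((X.chainComplex intCoeff.{u}).d (n + 1) n).hom

lemma boundary_boundary {n : ℕ} (c : Chain X (n + 2)) : boundary n (boundary (n + 1) c) = 0 :=
  congrArg (fun f => f.hom c) ((X.chainComplex intCoeff.{u}).d_comp_d (n + 2) (n + 1) n)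

/-- The chain given by a single simplex. -/
def simplexChain {n : ℕ} (σ : Simplex X n) : Chain X n :=
  (X.ιChainComplex (R := intCoeff.{u}) σ).hom (ULift.up 1)

lemma span_simplexChain (n : ℕ) :
    Submodule.span ℤ (Set.range (simplexChain (X := X) (n := n))) = ⊤ := by
  refine ModuleCat.submodule_eq_top_of_hom_ext _ fun T f g h => ?_
  refine SSet.chainComplex_hom_ext fun σ => ?_
  exact ModuleCat.hom_ext (LinearMap.ext_ulift (h _ (Submodule.subset_span ⟨σ, rfl⟩)))

lemma chain_hom_ext {n : ℕ} {G : Type*} [AddCommGroup G] {f g : Chain X n →+ G}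
    (h : ∀ σ, f (simplexChain σ) = g (simplexChain σ)) : f = g :=
  AddMonoidHom.eq_of_eqOn_span_int (span_simplexChain n) (by rintro _ ⟨σ, rfl⟩; exact h σ)

instance (n : ℕ) : IsAddTorsionFree (Chain X n) := by
  let f : Chain X n ⟶ ModuleCat.of ℤ (Simplex X n →₀ ℤ) :=
    Limits.Cofan.IsColimit.desc (X.isColimitChainComplexXCofan intCoeff.{u} n) fun σ =>
      ModuleCat.ofHom ((Finsupp.lsingle σ).comp
        (ULift.moduleEquiv : ULift.{u} ℤ ≃ₗ[ℤ] ℤ).toLinearMap)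
  have hf : ∀ σ, f.hom (simplexChain σ) = Finsupp.single σ 1 := fun σ =>
    congrArg (fun g : intCoeff.{u} ⟶ ModuleCat.of ℤ (Simplex X n →₀ ℤ) => g.hom (ULift.up 1))
      (Limits.Cofan.IsColimit.fac (X.isColimitChainComplexXCofan intCoeff.{u} n) _ σ)
  let g : (Simplex X n →₀ ℤ) →ₗ[ℤ] Chain X n := Finsupp.linearCombination ℤ simplexChain
  have hgf : g.toAddMonoidHom.comp f.hom.toAddMonoidHom = AddMonoidHom.id _ :=
    chain_hom_ext fun σ => by
      change g (f.hom (simplexChain σ)) = simplexChain σ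
      rw [hf, Finsupp.linearCombination_single]
      exact @one_smul ℤ _ _ (Chain X n).isModule.toMulAction _
  have hinj : Function.Injective f.hom :=
    Function.LeftInverse.injective (g := g) fun c => DFunLike.congr_fun hgf c
  exact hinj.isAddTorsionFree f.hom.toAddMonoidHom

variable {R : Type} [CommRing R]

/-- The evaluation of a cochain on integral chains. -/
def chainEval {n : ℕ} (φ : Cochain X R n) : Chain X n →+ R where
  toFun c := ((evalChain φ).hom c).down
  map_zero' := by simp
  map_add' := by simp

@[simp]
lemma chainEval_simplexChain {n : ℕ} (φ : Cochain X R n) (σ : Simplex X n) :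
    chainEval φ (simplexChain σ) = φ σ := by
  have := congrArg (fun f => (f.hom (ULift.up 1)).down) (ι_evalChain φ σ)
  exact this.trans (by simp)

lemma chainEval_boundary {n : ℕ} (φ : Cochain X R n) (c : Chain X (n + 1)) :
    chainEval φ (boundary n c) = chainEval (coboundary X R n φ) c :=
  congrArg (fun f => (f.hom c).down) (d_evalChain φ)

lemma chainEval_apply_simplexChain {n : ℕ} (f : Chain X n →+ R) :
    chainEval (fun σ => f (simplexChain σ)) = f :=
  chain_hom_ext fun σ => by simp

lemma chainEval_comp {n : ℕ} {R' : Type} [CommRing R'] (g : R →+ R') (φ : Cochain X R n) :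
    chainEval (fun σ => g (φ σ)) = g.comp (chainEval φ) :=
  chain_hom_ext fun σ => by simp

lemma coboundary_apply {n : ℕ} (φ : Cochain X R n) (σ : Simplex X (n + 1)) :
    coboundary X R n φ σ = chainEval φ (boundary n (simplexChain σ)) := by
  rw [chainEval_boundary, chainEval_simplexChain]

lemma pairing_mk_eq {n : ℕ} (φ : cocycles X R n)
    (B : (X.homology intCoeff.{u} n : ModuleCat.{u} ℤ)) (c : Chain X n)
    (hc : ((X.chainComplex intCoeff.{u}).homologyι n).hom B =
      ((X.chainComplex intCoeff.{u}).pOpcycles n).hom c) :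
    pairing (Submodule.Quotient.mk φ : Cohomology X R n) B = chainEval φ.1 c := by
  change ((evalHomology φ).hom B).down = _
  rw [evalHomology, ModuleCat.hom_comp, LinearMap.comp_apply, hc]
  exact congrArg (fun f => (f.hom c).down)
    ((X.chainComplex intCoeff.{u}).p_descOpcycles (evalChain φ.1) _ _ _)

/-- A class pairs to zero with integral homology iff it vanishes on all integral cycles. -/
lemma forall_pairing_eq_zero_iff {n : ℕ} (φ : cocycles X R (n + 1)) :
    (∀ B, pairing (Submodule.Quotient.mk φ : Cohomology X R (n + 1)) B = 0) ↔
      ∀ c, boundary n c = 0 → chainEval φ.1 c = 0 := by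
  constructor
  · intro h c hc
    obtain ⟨B, hB⟩ := (X.chainComplex intCoeff.{u}).exists_homologyι_apply_eq
      (ChainComplex.next_nat_succ n) c hc
    rw [← pairing_mk_eq φ B c hB, h]
  · intro h B
    obtain ⟨c, hc, hB⟩ := (X.chainComplex intCoeff.{u}).exists_cycle_homologyι_apply_eq (n + 1) n B
    rw [pairing_mk_eq φ B c hB, h c hc]

/-- Elements of order `4` in homology, in terms of chains. -/
lemma exists_addOrderOf_eq_four_iff (n : ℕ) :
    (∃ x : (X.homology intCoeff.{u} (n + 1) : ModuleCat.{u} ℤ), addOrderOf x = 4) ↔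
      ∃ c : Chain X (n + 1), (∃ e, boundary (n + 1) e = 4 • c) ∧
        ¬ ∃ e, boundary (n + 1) e = 2 • c := by
  set K := X.chainComplex intCoeff.{u}
  have key : ∀ (x : K.homology (n + 1)) (c : Chain X (n + 1)),
      (K.homologyι (n + 1)).hom x = (K.pOpcycles (n + 1)).hom c → ∀ k : ℕ,
      k • x = 0 ↔ ∃ e, boundary (n + 1) e = k • c := by
    intro x c h k
    rw [← K.pOpcycles_apply_eq_zero_iff (ChainComplex.prev ℕ (n + 1)), map_nsmul, ← h,
      ← map_nsmul, map_eq_zero_iff _ (K.homologyι_apply_injective (n + 1))]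
  have order : ∀ x : K.homology (n + 1), addOrderOf x = 4 ↔ 4 • x = 0 ∧ ¬ 2 • x = 0 := by
    intro x
    constructor
    · intro h
      rw [← addOrderOf_dvd_iff_nsmul_eq_zero, ← addOrderOf_dvd_iff_nsmul_eq_zero, h]
      decide
    · rintro ⟨h4, h2⟩
      exact addOrderOf_eq_prime_pow (p := 2) (n := 1) (by simpa using h2) (by simpa using h4)
  constructor
  · rintro ⟨x, hx⟩
    obtain ⟨c, -, hc⟩ := K.exists_cycle_homologyι_apply_eq (n + 1) n x
    rw [order, key x c hc, key x c hc] at hx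
    exact ⟨c, hx⟩
  · rintro ⟨c, ⟨e, he⟩, hc⟩
    have hcyc : boundary n c = 0 := by
      have := boundary_boundary e
      rw [he, map_nsmul] at this
      exact (nsmul_eq_zero_iff_right (by decide)).1 this
    obtain ⟨x, hx⟩ := K.exists_homologyι_apply_eq (ChainComplex.next_nat_succ n) c hcyc
    exact ⟨x, by rw [order, key x c hx, key x c hx]; exact ⟨⟨e, he⟩, hc⟩⟩

end Chains

section Squares

variable {X : SSet.{u}}

/-- The injection `ℤ/2 → ℤ/4`, multiplication by `2`. -/
def double : ZMod 2 →+ ZMod 4 where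
  toFun x := 2 * (x.val : ZMod 4)
  map_zero' := by decide
  map_add' := by decide

/-- The Bockstein relation `d (κ₁ + 2 φ) = 2 (κ ∪ κ + d φ)` modulo `4`, where `κ₁` is the lift of
`κ` with values in `{0, 1}`. -/
lemma coboundary_lift_add_double {κ : Cochain X (ZMod 2) 1} (hκ : κ ∈ cocycles X (ZMod 2) 1)
    (φ : Cochain X (ZMod 2) 1) :
    coboundary X (ZMod 4) 1 (fun σ => ((κ σ).val : ZMod 4) + double (φ σ)) =
      fun σ => double ((cupCochain κ κ + coboundary X (ZMod 2) 1 φ) σ) := by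
  funext σ
  have h := congrFun (LinearMap.mem_ker.1 hκ) σ
  rw [coboundary_one_apply, Pi.zero_apply] at h
  rw [coboundary_one_apply, Pi.add_apply, coboundary_one_apply, map_add, map_add, map_sub]
  have key : ∀ a b c : ZMod 2, a - b + c = 0 →
      (a.val : ZMod 4) - b.val + c.val = double (c * a) := by decide
  simp only [cupCochain]
  linear_combination key _ _ _ h

/-- A cochain modulo `4` whose coboundary is twice `w` exhibits `w` as a square up to a
coboundary. -/
lemma exists_eq_cup_add_coboundary {w : Cochain X (ZMod 2) 2} {μ : Cochain X (ZMod 4) 1}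
    (h : coboundary X (ZMod 4) 1 μ = fun σ => double (w σ)) :
    ∃ κ ∈ cocycles X (ZMod 2) 1, ∃ φ, w = cupCochain κ κ + coboundary X (ZMod 2) 1 φ := by
  have key₁ : ∀ a b c : ZMod 4, ∀ w : ZMod 2, a - b + c = double w →
      (a.val : ZMod 2) - b.val + c.val = 0 := by decide
  have key₂ : ∀ a b c : ZMod 4, ∀ w : ZMod 2, a - b + c = double w →
      w = (c.val : ZMod 2) * a.val +
        (((a.val / 2 : ℕ) : ZMod 2) - (b.val / 2 : ℕ) + (c.val / 2 : ℕ)) := by decide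
  have h' : ∀ σ, μ (X.δ 0 σ) - μ (X.δ 1 σ) + μ (X.δ 2 σ) = double (w σ) := fun σ => by
    rw [← coboundary_one_apply, h]
  refine ⟨fun σ => (μ σ).val, LinearMap.mem_ker.2 ?_, fun σ => ((μ σ).val / 2 : ℕ), ?_⟩
  · funext σ
    rw [coboundary_one_apply]
    exact key₁ _ _ _ _ (h' σ)
  · funext σ
    rw [Pi.add_apply, coboundary_one_apply]
    exact key₂ _ _ _ _ (h' σ)

lemma mk_eq_cup_iff (w : cocycles X (ZMod 2) 2) :
    (∃ κ : Cohomology X (ZMod 2) 1, (Submodule.Quotient.mk w : Cohomology X (ZMod 2) 2) = cup κ κ) ↔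
      ∃ μ : Cochain X (ZMod 4) 1, coboundary X (ZMod 4) 1 μ = fun σ => double (w.1 σ) := by
  constructor
  · rintro ⟨κ, hκ⟩
    obtain ⟨κ, rfl⟩ := Submodule.Quotient.mk_surjective _ κ
    have : w.1 - cupCochain κ.1 κ.1 ∈ coboundaries X (ZMod 2) 2 :=
      (Submodule.Quotient.eq ((coboundaries X (ZMod 2) 2).submoduleOf (cocycles X (ZMod 2) 2))
        (x := w) (y := ⟨_, cupCochain_mem_cocycles κ.2 κ.2⟩)).1 hκ
    obtain ⟨φ, hφ⟩ := this
    refine ⟨_, (coboundary_lift_add_double κ.2 φ).trans ?_⟩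
    rw [hφ, add_sub_cancel]
  · rintro ⟨μ, hμ⟩
    obtain ⟨κ, hκ, φ, hw⟩ := exists_eq_cup_add_coboundary hμ
    refine ⟨Submodule.Quotient.mk ⟨κ, hκ⟩, ?_⟩
    refine (Submodule.Quotient.eq ((coboundaries X (ZMod 2) 2).submoduleOf
      (cocycles X (ZMod 2) 2)) (x := w) (y := ⟨_, cupCochain_mem_cocycles hκ hκ⟩)).2 ⟨φ, ?_⟩
    change _ = w.1 - cupCochain κ κ
    rw [hw, add_sub_cancel_left]

lemma double_injective : Function.Injective double := by decide

lemma double_chainEval {n : ℕ} {w : Cochain X (ZMod 2) (n + 1)} {μ : Cochain X (ZMod 4) n}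
    (h : coboundary X (ZMod 4) n μ = fun σ => double (w σ)) (e : Chain X (n + 1)) :
    double (chainEval w e) = chainEval μ (boundary n e) := by
  rw [chainEval_boundary, h, chainEval_comp, AddMonoidHom.comp_apply]

theorem pairing_cup_self (κ : Cohomology X (ZMod 2) 1)
    (B : (X.homology intCoeff.{u} 2 : ModuleCat.{u} ℤ)) :
    pairing (cup κ κ) B = 0 := by
  obtain ⟨w, hw⟩ := Submodule.Quotient.mk_surjective _ (cup κ κ)
  obtain ⟨μ, hμ⟩ := (mk_eq_cup_iff w).1 ⟨κ, hw⟩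
  rw [← hw]
  refine (forall_pairing_eq_zero_iff w).2 (fun c hc => double_injective ?_) B
  rw [double_chainEval hμ, hc, map_zero, map_zero]

theorem exists_eq_cup_self_of_forall_pairing_eq_zero
    (hX : ∀ x : (X.homology intCoeff.{u} 1 : ModuleCat.{u} ℤ), addOrderOf x ≠ 4)
    (w : Cohomology X (ZMod 2) 2)
    (hw : ∀ B, pairing w B = 0) : ∃ κ, w = cup κ κ := by
  obtain ⟨w, rfl⟩ := Submodule.Quotient.mk_surjective _ w
  rw [forall_pairing_eq_zero_iff] at hw
  have hX' := mt (exists_addOrderOf_eq_four_iff 0).2 (not_exists.2 hX)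
  push Not at hX'
  obtain ⟨m, hm⟩ := exists_comp_eq_of_zmod_four (boundary (X := X) 1).toAddMonoidHom
    (double.comp (chainEval w.1)) fun e c he => by
      obtain ⟨f, hf⟩ := hX' c ⟨e, he⟩
      have h := hw (e - 2 • f) (by
        rw [map_sub, map_nsmul, hf, ← mul_nsmul]
        exact sub_eq_zero.2 he)
      rw [map_sub, map_nsmul, CharTwo.two_nsmul, sub_zero] at h
      rw [AddMonoidHom.comp_apply, h, map_zero]
  refine (mk_eq_cup_iff w).2 ⟨fun σ => m (simplexChain σ), ?_⟩
  funext σ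
  rw [coboundary_apply, chainEval_apply_simplexChain]
  exact (DFunLike.congr_fun hm (simplexChain σ)).trans (by simp)

theorem addOrderOf_ne_four_of_forall_exists_eq_cup_self
    (hX : ∀ w : Cohomology X (ZMod 2) 2, (∀ B, pairing w B = 0) → ∃ κ, w = cup κ κ)
    (x : (X.homology intCoeff.{u} 1 : ModuleCat.{u} ℤ)) : addOrderOf x ≠ 4 := by
  intro hx
  obtain ⟨c, ⟨e, he⟩, hc⟩ := (exists_addOrderOf_eq_four_iff 0).1 ⟨x, hx⟩
  obtain ⟨g, hg, hge⟩ := exists_hom_zmod_two_ne_zero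
    (boundary (X := X) 1).toAddMonoidHom.ker e fun f hf => hc ⟨f, by
      have h : boundary 1 (e - 2 • f) = 0 := hf
      rw [map_sub, map_nsmul, he, sub_eq_zero, show 4 = 2 * 2 from rfl, mul_nsmul] at h
      exact (nsmul_right_injective two_ne_zero h).symm⟩
  let w : cocycles X (ZMod 2) 2 := ⟨fun σ => g (simplexChain σ), LinearMap.mem_ker.2 (by
    funext σ
    rw [coboundary_apply, chainEval_apply_simplexChain]
    exact hg _ (AddMonoidHom.mem_ker.2 (boundary_boundary (n := 1) (simplexChain σ))))⟩
  have hwg : chainEval w.1 = g := chainEval_apply_simplexChain g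
  obtain ⟨μ, hμ⟩ := (mk_eq_cup_iff w).1 (hX _ ((forall_pairing_eq_zero_iff w).2 fun c hc => by
    rw [hwg]
    exact hg c hc))
  have h := double_chainEval hμ e
  rw [hwg, he, map_nsmul, ← Nat.cast_smul_eq_nsmul (ZMod 4), CharP.cast_eq_zero, zero_smul,
    ← map_zero double] at h
  exact hge (double_injective h)

end Squares

end SingularCohomology

end

theorem corollary2p3 (M : Type u) [TopologicalSpace M] :
    {w : SingularCohomology.singularCohomology M 2 |
        ∀ B : SingularCohomology.singularHomology M 2, SingularCohomology.evalOn w B = 0} ⊇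
      {w | ∃ κ : SingularCohomology.singularCohomology M 1, w = SingularCohomology.cup κ κ} ∧
    (Module.Finite ℤ (SingularCohomology.singularHomology M 1) →
      ({w : SingularCohomology.singularCohomology M 2 |
          ∀ B : SingularCohomology.singularHomology M 2, SingularCohomology.evalOn w B = 0} ⊆
        {w | ∃ κ : SingularCohomology.singularCohomology M 1, w = SingularCohomology.cup κ κ} ↔
      ∀ x : SingularCohomology.singularHomology M 1, addOrderOf x ≠ 4)) := by
  refine ⟨?_, fun _ => ⟨fun h => ?_, fun h w hw => ?_⟩⟩
  · rintro _ ⟨κ, rfl⟩ B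
    exact SingularCohomology.pairing_cup_self κ B
  · exact SingularCohomology.addOrderOf_ne_four_of_forall_exists_eq_cup_self
      fun w hw => h (show ∀ B, _ from hw)
  · exact SingularCohomology.exists_eq_cup_self_of_forall_pairing_eq_zero h w hw
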